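/- Let $Z$ be a real $n\times r$ matrix with columns $z_1,\dots,z_r$ such that the zonotope $P(Z)=\{Zy : y\in[-1,1]^r\}\subset\mathbb R^n$ is an $n$-dimensional parallelotope (a convex polytope whose translates, with pairwise disjoint interiors, tile $\mathbb R^n$ facet to facet). Let $\beta_1,\dots,\beta_r>0$ be scalars such that the system $\{\beta_iz_i : 1\le i\le r\}$ is unimodular, i.e. every vector of the system is an integer linear combination of any $n$ linearly independent vectors of the system. Let $Z_\beta$ be the $n\times r$ matrix with columns $\sqrt{2\beta_i}\,z_i$. Then $Z_\beta Z_\beta^T$ is positive definite; put $Q=(Z_\beta Z_\beta^T)^{-1}$. (a) Let $p$ be an outward normal vector of a facet $F$ of $P(Z)$. The facet $F$ is centrally symmetric; let $t$ be its translation vector, i.e. $\tfrac12 t$ is the centre of $F$. There is a scalar $\gamma>0$ such that $\gamma p^T(\beta_iz_i)\in\{0,\pm1\}$ for all $i$, and for every such $\gamma$ $$\gamma p=Qt .$$ (b) There are real $n\times n$ matrices $A$ with $A^TA=Q$. For every such $A$, the map $x\mapsto Ax$ maps $P(Z)$ onto a Voronoi polytope: if $\mathcal T$ is the set of translation vectors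 $t$ of the facets of $P(Z)$, then the set $L$ of integer linear combinations of the vectors $At$, $t\in\mathcal T$, is a lattice of full rank in $\mathbb R^n$, and $$A\,P(Z)=\{x\in\mathbb R^n : \|x\|\le\|x-v\|\ \text{ for all } v\in L\}$$ with the Euclidean norm $\|\cdot\|$. -/

import Mathlib

open scoped Matrix Pointwise

/-- The zonotope `P(Z)`: the Minkowski sum of the segments `[-zᵢ, zᵢ]`, with `zᵢ` the columns of
the `n × r` matrix `Z`. -/
def zonotope {n r : ℕ} (Z : Matrix (Fin n) (Fin r) ℝ) : Set (Fin n → ℝ) :=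
  {x | ∃ y : Fin r → ℝ, (∀ i, -1 ≤ y i ∧ y i ≤ 1) ∧ x = Z *ᵥ y}

/-- The face of `P` on which the linear functional `x ↦ pᵀx` attains its maximum over `P`. -/
def faceOf {n : ℕ} (P : Set (Fin n → ℝ)) (p : Fin n → ℝ) : Set (Fin n → ℝ) :=
  {x | x ∈ P ∧ ∀ y ∈ P, p ⬝ᵥ y ≤ p ⬝ᵥ x}

/-- `p` is an (outward) facet vector of the `n`-dimensional polytope `P`: the face of `P` in
direction `p` has dimension `n - 1`. -/
def IsFacetVector {n : ℕ} (P : Set (Fin n → ℝ)) (p : Fin n → ℝ) : Prop :=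
  p ≠ 0 ∧ (faceOf P p).Nonempty ∧ Module.finrank ℝ (vectorSpan ℝ (faceOf P p)) + 1 = n

/-- `F` is a facet of the `n`-dimensional polytope `P`. -/
def IsFacet {n : ℕ} (P F : Set (Fin n → ℝ)) : Prop :=
  ∃ p : Fin n → ℝ, IsFacetVector P p ∧ F = faceOf P p

/-- `c` is a centre of symmetry of `F`. -/
def IsCenter {n : ℕ} (F : Set (Fin n → ℝ)) (c : Fin n → ℝ) : Prop :=
  ∀ x ∈ F, (2 : ℝ) • c - x ∈ F

/-- `t` is the translation vector of the facet of `P` with facet vector `p`: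
the centre of that facet is `t / 2`. -/
def IsTranslationVector {n : ℕ} (P : Set (Fin n → ℝ)) (p t : Fin n → ℝ) : Prop :=
  IsFacetVector P p ∧ IsCenter (faceOf P p) ((1 / 2 : ℝ) • t)

/-- The set `±𝒯` of the translation vectors of all facets of `P`. -/
def translationVectors {n : ℕ} (P : Set (Fin n → ℝ)) : Set (Fin n → ℝ) :=
  {t | ∃ p : Fin n → ℝ, IsTranslationVector P p t}

/-- An `n`-dimensional parallelotope in `ℝⁿ`: a convex polytope with nonempty interior which fills
the space, facet to facet, by translation copies with pairwise disjoint interiors. -/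
def IsParallelotope {n : ℕ} (P : Set (Fin n → ℝ)) : Prop :=
  (∃ V : Set (Fin n → ℝ), V.Finite ∧ P = convexHull ℝ V) ∧
  (interior P).Nonempty ∧
  ∃ T : Set (Fin n → ℝ),
    (⋃ t ∈ T, (t +ᵥ P)) = Set.univ ∧
    T.PairwiseDisjoint (fun t => interior (t +ᵥ P)) ∧
    ∀ t ∈ T, ∀ F, IsFacet (t +ᵥ P) F →
      ∃ t' ∈ T, (t +ᵥ P) ∩ (t' +ᵥ P) = F ∧ IsFacet (t' +ᵥ P) F

/-- A system of vectors in `ℝⁿ` is unimodular if every vector of it is an integer linear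
combination of any `n` linearly independent vectors of it. -/
def IsUnimodularSystem {n r : ℕ} (x : Fin r → (Fin n → ℝ)) : Prop :=
  ∀ b : Fin n → Fin r, LinearIndependent ℝ (fun k => x (b k)) →
    ∀ i, x i ∈ Submodule.span ℤ (Set.range fun k => x (b k))

/-- The multiple `γ • p` (`γ > 0`) of a facet vector takes only the values `0`, `1`, `-1` on the
vectors `βᵢ zᵢ`. -/
def IsRegularScaling {n r : ℕ} (Z : Matrix (Fin n) (Fin r) ℝ) (β : Fin r → ℝ)
    (p : Fin n → ℝ) (γ : ℝ) : Prop :=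
  0 < γ ∧ ∀ i, γ * (p ⬝ᵥ (β i • Z.col i)) ∈ ({0, 1, -1} : Set ℝ)

/-- The matrix `Z_β` with columns `√(2 βᵢ) zᵢ`. -/
noncomputable def scaledMatrix {n r : ℕ} (Z : Matrix (Fin n) (Fin r) ℝ) (β : Fin r → ℝ) :
    Matrix (Fin n) (Fin r) ℝ :=
  Matrix.of fun k i => Real.sqrt (2 * β i) * Z k i

/-- `L` is a lattice in `ℝⁿ`: a discrete subgroup which spans `ℝⁿ`. -/
def IsLatticeIn {n : ℕ} (L : Submodule ℤ (Fin n → ℝ)) : Prop :=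
  ∃ _ : DiscreteTopology L, IsZLattice ℝ L

/-- The Voronoi polytope of the point `0` of `L`, for the Euclidean norm `x² = xᵀx`: the points
at least as near to `0` as to any other point of `L`. -/
def voronoiPolytope {n : ℕ} (L : Submodule ℤ (Fin n → ℝ)) : Set (Fin n → ℝ) :=
  {x | ∀ v ∈ L, x ⬝ᵥ x ≤ (x - v) ⬝ᵥ (x - v)}

/-! Let `S = Z_β Z_βᵀ`, so `S w = ∑ 2βᵢ (w·zᵢ) zᵢ`. The face of the zonotope in direction `p` has
the unique centre `∑ sign(p·zᵢ) zᵢ`. Unimodularity forces all nonzero values `p·(βᵢzᵢ)` of a facet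
vector to share one absolute value, so some `γ > 0` gives `γβᵢ(p·zᵢ) = sign(p·zᵢ)`. Then `S(γp)` is
twice the centre, that is `t`, which is (a).

For (b), let `AᵀA = S⁻¹`, let `v ∈ L` and `aᵢ = (Aᵀv)·zᵢ`. Part (a) gives `Aᵀ(At) = γp`, so every
`βᵢaᵢ` is an integer; also `v·v = ∑ 2βᵢaᵢ²`. For `x = AZy` with `y` in the cube, `2x·v = 2∑ yᵢaᵢ ≤
2∑ |aᵢ| ≤ v·v`, because `|m| ≤ m²` for integers; so the image lies in the Voronoi polytope.
Conversely, the Voronoi inequality for `v = At` is exactly the facet inequality of `p`, and facet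
inequalities cut out the zonotope (`exists_facetVector_of_notMem_zonotope`). -/

/-! ### Faces of a zonotope and their centres. -/

theorem dotProduct_mulVec_eq_sum {n r : ℕ} (Z : Matrix (Fin n) (Fin r) ℝ) (p : Fin n → ℝ)
    (y : Fin r → ℝ) : p ⬝ᵥ Z *ᵥ y = ∑ i, y i * (p ⬝ᵥ Z.col i) := by
  rw [Matrix.dotProduct_mulVec, dotProduct_comm]
  rfl

/-- The support function of the zonotope `P(Z)`. -/
noncomputable def supportValue {n r : ℕ} (Z : Matrix (Fin n) (Fin r) ℝ) (p : Fin n → ℝ) : ℝ :=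
  ∑ i, |p ⬝ᵥ Z.col i|

/-- The signs of the values of `p` on the columns of `Z`. -/
noncomputable def signVector {n r : ℕ} (Z : Matrix (Fin n) (Fin r) ℝ) (p : Fin n → ℝ) :
    Fin r → ℝ :=
  fun i => (SignType.sign (p ⬝ᵥ Z.col i) : ℝ)

/-- The centre of the face of `P(Z)` in direction `p`. -/
noncomputable def faceCenter {n r : ℕ} (Z : Matrix (Fin n) (Fin r) ℝ) (p : Fin n → ℝ) :
    Fin n → ℝ :=
  Z *ᵥ signVector Z p

/-- The span of the columns of `Z` orthogonal to `p`. -/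
def orthogonalSpan {n r : ℕ} (Z : Matrix (Fin n) (Fin r) ℝ) (p : Fin n → ℝ) :
    Submodule ℝ (Fin n → ℝ) :=
  Submodule.span ℝ (Z.col '' {i | p ⬝ᵥ Z.col i = 0})

theorem abs_sign_le_one (x : ℝ) : -1 ≤ (SignType.sign x : ℝ) ∧ (SignType.sign x : ℝ) ≤ 1 := by
  rcases lt_trichotomy x 0 with h | h | h
  · simp [sign_neg h]
  · simp [h]
  · simp [sign_pos h]

theorem mul_le_abs_of_mem_Icc {a x : ℝ} (h : -1 ≤ a ∧ a ≤ 1) : a * x ≤ |x| := by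
  calc a * x ≤ |a * x| := le_abs_self _
    _ = |a| * |x| := abs_mul _ _
    _ ≤ 1 * |x| := by gcongr; exact abs_le.2 h
    _ = |x| := one_mul _

theorem eq_sign_of_mul_eq_abs {a x : ℝ} (hx : x ≠ 0) (h : a * x = |x|) :
    a = (SignType.sign x : ℝ) := by
  rw [← sign_mul_self] at h
  exact mul_right_cancel₀ hx h

theorem dotProduct_le_supportValue {n r : ℕ} (Z : Matrix (Fin n) (Fin r) ℝ) (p : Fin n → ℝ)
    {x : Fin n → ℝ} (hx : x ∈ zonotope Z) : p ⬝ᵥ x ≤ supportValue Z p := by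
  obtain ⟨y, hy, rfl⟩ := hx
  rw [dotProduct_mulVec_eq_sum]
  exact Finset.sum_le_sum fun i _ => mul_le_abs_of_mem_Icc (hy i)

theorem faceCenter_mem_zonotope {n r : ℕ} (Z : Matrix (Fin n) (Fin r) ℝ) (p : Fin n → ℝ) :
    faceCenter Z p ∈ zonotope Z :=
  ⟨_, fun _ => abs_sign_le_one _, rfl⟩

theorem dotProduct_faceCenter {n r : ℕ} (Z : Matrix (Fin n) (Fin r) ℝ) (p : Fin n → ℝ) :
    p ⬝ᵥ faceCenter Z p = supportValue Z p := by
  rw [faceCenter, dotProduct_mulVec_eq_sum]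
  exact Finset.sum_congr rfl fun i _ => sign_mul_self _

/-- Each summand satisfies `yᵢ(p·zᵢ) ≤ |p·zᵢ|`, so a maximum of the sum requires equality term by
term. -/
theorem mem_faceOf_zonotope {n r : ℕ} (Z : Matrix (Fin n) (Fin r) ℝ) (p x : Fin n → ℝ) :
    x ∈ faceOf (zonotope Z) p ↔
      ∃ y : Fin r → ℝ, (∀ i, -1 ≤ y i ∧ y i ≤ 1) ∧ x = Z *ᵥ y ∧
        ∀ i, p ⬝ᵥ Z.col i ≠ 0 → y i = signVector Z p i := by
  constructor
  · rintro ⟨⟨y, hy, rfl⟩, hmax⟩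
    refine ⟨y, hy, rfl, fun i hi => eq_sign_of_mul_eq_abs hi ?_⟩
    have h := hmax _ (faceCenter_mem_zonotope Z p)
    rw [dotProduct_faceCenter, dotProduct_mulVec_eq_sum, supportValue] at h
    have hle : ∀ j ∈ Finset.univ, y j * (p ⬝ᵥ Z.col j) ≤ |p ⬝ᵥ Z.col j| :=
      fun j _ => mul_le_abs_of_mem_Icc (hy j)
    exact (Finset.sum_eq_sum_iff_of_le hle).1 (le_antisymm (Finset.sum_le_sum hle) h) i
      (Finset.mem_univ i)
  · rintro ⟨y, hy, rfl, hs⟩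
    refine ⟨⟨y, hy, rfl⟩, fun x hx => (dotProduct_le_supportValue Z p hx).trans_eq ?_⟩
    rw [dotProduct_mulVec_eq_sum]
    refine Finset.sum_congr rfl fun i _ => ?_
    by_cases hi : p ⬝ᵥ Z.col i = 0
    · simp [hi]
    · rw [hs i hi]
      exact (sign_mul_self _).symm

theorem faceCenter_mem_faceOf {n r : ℕ} (Z : Matrix (Fin n) (Fin r) ℝ) (p : Fin n → ℝ) :
    faceCenter Z p ∈ faceOf (zonotope Z) p :=
  (mem_faceOf_zonotope Z p _).2 ⟨_, fun _ => abs_sign_le_one _, rfl, fun _ _ => rfl⟩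

theorem isCenter_faceCenter {n r : ℕ} (Z : Matrix (Fin n) (Fin r) ℝ) (p : Fin n → ℝ) :
    IsCenter (faceOf (zonotope Z) p) (faceCenter Z p) := by
  intro x hx
  obtain ⟨y, hy, rfl, hs⟩ := (mem_faceOf_zonotope Z p x).1 hx
  rw [mem_faceOf_zonotope]
  -- Reflecting in the centre negates the free coefficients and keeps the forced ones.
  refine ⟨fun i => if p ⬝ᵥ Z.col i = 0 then - y i else y i, fun i => ?_, ?_, fun i hi => ?_⟩
  · have := hy i
    dsimp only
    split_ifs <;> constructor <;> linarith
  · rw [faceCenter, ← Matrix.mulVec_smul, ← Matrix.mulVec_sub]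
    congr 1
    funext i
    by_cases hi : p ⬝ᵥ Z.col i = 0
    · simp [signVector, hi]
    · simp only [Pi.sub_apply, Pi.smul_apply, smul_eq_mul, if_neg hi, hs i hi]
      ring
  · simp only [if_neg hi, hs i hi]

/-- A centre of a face of a zonotope is unique. -/
theorem IsCenter.eq_faceCenter {n r : ℕ} {Z : Matrix (Fin n) (Fin r) ℝ} {p c : Fin n → ℝ}
    (hc : IsCenter (faceOf (zonotope Z) p) c) : c = faceCenter Z p := by
  set d := c - faceCenter Z p with hd
  -- Composing the two central reflections gives translation by `2d`; iterating it would make the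
  -- face unbounded unless `d = 0`.
  have step : ∀ x ∈ faceOf (zonotope Z) p, x + (2 : ℝ) • d ∈ faceOf (zonotope Z) p := by
    intro x hx
    have h := hc _ (isCenter_faceCenter Z p x hx)
    convert h using 1
    rw [hd]
    module
  have iter : ∀ k : ℕ, faceCenter Z p + (2 * k : ℝ) • d ∈ faceOf (zonotope Z) p := by
    intro k
    induction k with
    | zero => simpa using faceCenter_mem_faceOf Z p
    | succ k ih =>
      convert step _ ih using 1
      push_cast
      module
  have hdd : d ⬝ᵥ d = 0 := by
    by_contra hne
    have hpos : 0 < d ⬝ᵥ d := lt_of_le_of_ne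
      (Finset.sum_nonneg fun i _ => mul_self_nonneg (d i)) (Ne.symm hne)
    obtain ⟨k, hk⟩ := exists_nat_gt ((supportValue Z d - d ⬝ᵥ faceCenter Z p) / (d ⬝ᵥ d))
    rw [div_lt_iff₀ hpos] at hk
    have h := dotProduct_le_supportValue Z d (iter k).1
    rw [dotProduct_add, dotProduct_smul, smul_eq_mul] at h
    nlinarith [mul_nonneg (Nat.cast_nonneg (α := ℝ) k) hpos.le]
  exact sub_eq_zero.1 (dotProduct_self_eq_zero.1 hdd)

theorem mulVec_mem_orthogonalSpan {n r : ℕ} (Z : Matrix (Fin n) (Fin r) ℝ) (p : Fin n → ℝ)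
    {y : Fin r → ℝ} (hy : ∀ i, p ⬝ᵥ Z.col i ≠ 0 → y i = 0) :
    Z *ᵥ y ∈ orthogonalSpan Z p := by
  have h : Z *ᵥ y = ∑ i, y i • Z.col i := by
    funext k
    simp [Matrix.mulVec, dotProduct, mul_comm]
  rw [h]
  refine Submodule.sum_mem _ fun i _ => ?_
  by_cases hi : p ⬝ᵥ Z.col i = 0
  · exact Submodule.smul_mem _ _ (Submodule.subset_span ⟨i, hi, rfl⟩)
  · simp [hy i hi]

theorem vectorSpan_faceOf_zonotope {n r : ℕ} (Z : Matrix (Fin n) (Fin r) ℝ) (p : Fin n → ℝ) :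
    vectorSpan ℝ (faceOf (zonotope Z) p) = orthogonalSpan Z p := by
  apply le_antisymm
  · rw [vectorSpan, Submodule.span_le]
    rintro _ ⟨a, ha, b, hb, rfl⟩
    obtain ⟨y, -, rfl, hy⟩ := (mem_faceOf_zonotope Z p a).1 ha
    obtain ⟨y', -, rfl, hy'⟩ := (mem_faceOf_zonotope Z p b).1 hb
    simp only [vsub_eq_sub, ← Matrix.mulVec_sub]
    exact mulVec_mem_orthogonalSpan Z p fun i hi => by simp [hy i hi, hy' i hi]
  · rw [orthogonalSpan, Submodule.span_le]
    rintro _ ⟨i, hi, rfl⟩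
    have hmem : faceCenter Z p + Z.col i ∈ faceOf (zonotope Z) p := by
      rw [mem_faceOf_zonotope]
      -- The sign vector vanishes at `i`, so adding `1` there stays within the cube.
      refine ⟨signVector Z p + Pi.single i 1, fun j => ?_, ?_, fun j hj => ?_⟩
      · by_cases hij : j = i
        · subst hij
          simp [signVector, Set.mem_ofPred_eq ▸ hi]
        · simp only [Pi.add_apply, Pi.single_eq_of_ne hij, add_zero]
          exact abs_sign_le_one _
      · rw [Matrix.mulVec_add, Matrix.mulVec_single_one, faceCenter]
      · have hij : j ≠ i := fun h => hj (h ▸ hi)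
        simp [hij]
    have := vsub_mem_vectorSpan ℝ hmem (faceCenter_mem_faceOf Z p)
    simpa using this

theorem isFacetVector_zonotope_iff {n r : ℕ} (Z : Matrix (Fin n) (Fin r) ℝ) (p : Fin n → ℝ) :
    IsFacetVector (zonotope Z) p ↔ p ≠ 0 ∧ Module.finrank ℝ (orthogonalSpan Z p) + 1 = n := by
  rw [IsFacetVector, vectorSpan_faceOf_zonotope]
  exact ⟨fun h => ⟨h.1, h.2.2⟩, fun h => ⟨h.1, ⟨_, faceCenter_mem_faceOf Z p⟩, h.2⟩⟩

theorem isTranslationVector_zonotope_iff {n r : ℕ} (Z : Matrix (Fin n) (Fin r) ℝ)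
    (p t : Fin n → ℝ) :
    IsTranslationVector (zonotope Z) p t ↔
      IsFacetVector (zonotope Z) p ∧ t = (2 : ℝ) • faceCenter Z p := by
  refine and_congr_right fun _ => ⟨fun h => ?_, ?_⟩
  · rw [← h.eq_faceCenter, smul_smul]
    norm_num
  · rintro rfl
    rw [smul_smul]
    norm_num
    exact isCenter_faceCenter Z p

/-! ### Zonotopes as intersections of facet half-spaces. -/

theorem exists_dotProduct_eq_zero_of_ne_top {n : ℕ} {U : Submodule ℝ (Fin n → ℝ)} (hU : U ≠ ⊤) :
    ∃ q : Fin n → ℝ, q ≠ 0 ∧ ∀ u ∈ U, q ⬝ᵥ u = 0 := by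
  obtain ⟨f, hf, hle⟩ := U.exists_le_ker_of_lt_top (lt_top_iff_ne_top.2 hU)
  refine ⟨(dotProductEquiv ℝ (Fin n)).symm f, by simpa using hf, fun u hu => ?_⟩
  have h : dotProductEquiv ℝ (Fin n) ((dotProductEquiv ℝ (Fin n)).symm f) u = 0 := by
    rw [LinearEquiv.apply_symm_apply]
    exact hle hu
  exact h

theorem dotProduct_eq_zero_of_mem_orthogonalSpan {n r : ℕ} {Z : Matrix (Fin n) (Fin r) ℝ}
    {p u : Fin n → ℝ} (hu : u ∈ orthogonalSpan Z p) : p ⬝ᵥ u = 0 := by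
  have : orthogonalSpan Z p ≤ LinearMap.ker (dotProductEquiv ℝ (Fin n) p) := by
    rw [orthogonalSpan, Submodule.span_le]
    rintro _ ⟨i, hi, rfl⟩
    exact hi
  exact this hu

theorem span_col_eq_top_of_interior_nonempty {n r : ℕ} {Z : Matrix (Fin n) (Fin r) ℝ}
    (h : (interior (zonotope Z)).Nonempty) : Submodule.span ℝ (Set.range Z.col) = ⊤ := by
  apply Submodule.eq_top_of_nonempty_interior'
  refine h.mono (interior_mono ?_)
  rintro _ ⟨y, -, rfl⟩
  rw [← Matrix.range_mulVecLin]
  exact ⟨y, rfl⟩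

theorem exists_dotProduct_col_ne_zero {n r : ℕ} {Z : Matrix (Fin n) (Fin r) ℝ}
    (hZ : Submodule.span ℝ (Set.range Z.col) = ⊤) {p : Fin n → ℝ} (hp : p ≠ 0) :
    ∃ i, p ⬝ᵥ Z.col i ≠ 0 := by
  by_contra! h
  have : Submodule.span ℝ (Set.range Z.col) ≤ LinearMap.ker (dotProductEquiv ℝ (Fin n) p) := by
    rw [Submodule.span_le]
    rintro _ ⟨i, rfl⟩
    exact h i
  rw [hZ] at this
  exact hp (dotProduct_self_eq_zero.1 (this (Submodule.mem_top (x := p))))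

/-- A strictly separating functional which is not a facet vector can be turned about its
orthogonal columns until it becomes orthogonal to one more column. -/
theorem exists_separating_finrank_lt {n r : ℕ} {Z : Matrix (Fin n) (Fin r) ℝ}
    (hZ : Submodule.span ℝ (Set.range Z.col) = ⊤) {p x : Fin n → ℝ}
    (hx : supportValue Z p < p ⬝ᵥ x) (hn : Module.finrank ℝ (orthogonalSpan Z p) + 1 < n) :
    ∃ p' : Fin n → ℝ, supportValue Z p' < p' ⬝ᵥ x ∧
      Module.finrank ℝ (orthogonalSpan Z p) < Module.finrank ℝ (orthogonalSpan Z p') := by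
  set g := faceCenter Z p - x with hg
  -- Codimension at least two leaves room for a direction `q` that is also orthogonal to `g`; moving
  -- along `q` then preserves the separation gap.
  have hU : orthogonalSpan Z p ⊔ Submodule.span ℝ {g} ≠ ⊤ := by
    intro h
    have h1 := Submodule.finrank_add_le_finrank_add_finrank (orthogonalSpan Z p)
      (Submodule.span ℝ {g})
    have h2 : Module.finrank ℝ (Submodule.span ℝ {g}) ≤ 1 := by
      simpa using finrank_span_le_card (R := ℝ) ({g} : Set (Fin n → ℝ))
    rw [h, finrank_top, Module.finrank_fin_fun] at h1
    omega
  obtain ⟨q, hq, hqU, j, hj⟩ : ∃ q : Fin n → ℝ, q ≠ 0 ∧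
      (∀ u ∈ orthogonalSpan Z p ⊔ Submodule.span ℝ {g}, q ⬝ᵥ u = 0) ∧
      ∃ j, (p ⬝ᵥ Z.col j) * (q ⬝ᵥ Z.col j) < 0 := by
    obtain ⟨q, hq, hqU⟩ := exists_dotProduct_eq_zero_of_ne_top hU
    obtain ⟨j, hj⟩ := exists_dotProduct_col_ne_zero hZ hq
    have hpj : p ⬝ᵥ Z.col j ≠ 0 := fun h => hj <|
      hqU _ (Submodule.mem_sup_left (Submodule.subset_span ⟨j, h, rfl⟩))
    rcases lt_or_gt_of_ne (mul_ne_zero hpj hj) with h | h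
    · exact ⟨q, hq, hqU, j, h⟩
    · refine ⟨-q, neg_ne_zero.2 hq, fun u hu => by simp [hqU u hu], j, ?_⟩
      rw [neg_dotProduct]
      linarith
  have hqN : ∀ i, p ⬝ᵥ Z.col i = 0 → q ⬝ᵥ Z.col i = 0 := fun i h =>
    hqU _ (Submodule.mem_sup_left (Submodule.subset_span ⟨i, h, rfl⟩))
  have hqg : q ⬝ᵥ g = 0 :=
    hqU _ (Submodule.mem_sup_right (Submodule.mem_span_singleton_self g))
  -- `s` is the first time at which `p + s • q` vanishes on a column where `p` does not; up to then
  -- no column value changes sign, so the old face centre still attains the maximum.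
  obtain ⟨m, hm, hmin⟩ := Finset.exists_min_image
    (Finset.univ.filter fun i => (p ⬝ᵥ Z.col i) * (q ⬝ᵥ Z.col i) < 0)
    (fun i => -(p ⬝ᵥ Z.col i) / (q ⬝ᵥ Z.col i)) ⟨j, by simpa using hj⟩
  simp only [Finset.mem_filter, Finset.mem_univ, true_and] at hm hmin
  set s := -(p ⬝ᵥ Z.col m) / (q ⬝ᵥ Z.col m) with hs
  have hqm : q ⬝ᵥ Z.col m ≠ 0 := fun h => by simp [h] at hm
  have hpm : p ⬝ᵥ Z.col m ≠ 0 := fun h => by simp [h] at hm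
  have hspos : 0 < s := by
    have : s = -((p ⬝ᵥ Z.col m) * (q ⬝ᵥ Z.col m)) / (q ⬝ᵥ Z.col m) ^ 2 := by
      rw [hs]; field_simp
    rw [this]
    exact div_pos (by linarith) (by positivity)
  have hval : ∀ i, (p + s • q) ⬝ᵥ Z.col i = p ⬝ᵥ Z.col i + s * (q ⬝ᵥ Z.col i) := fun i => by
    rw [add_dotProduct, smul_dotProduct, smul_eq_mul]
  have habs : ∀ i, |(p + s • q) ⬝ᵥ Z.col i| = signVector Z p i * ((p + s • q) ⬝ᵥ Z.col i) := by
    intro i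
    rw [hval, signVector]
    have key : (p ⬝ᵥ Z.col i) * (q ⬝ᵥ Z.col i) < 0 → s ≤ -(p ⬝ᵥ Z.col i) / (q ⬝ᵥ Z.col i) :=
      hmin i
    rcases lt_trichotomy (p ⬝ᵥ Z.col i) 0 with h | h | h
    · rw [sign_neg h, abs_of_nonpos]
      · simp
      · by_cases h' : 0 < q ⬝ᵥ Z.col i
        · have := key (mul_neg_of_neg_of_pos h h')
          rw [le_div_iff₀ h'] at this
          linarith
        · nlinarith
    · simp [h, hqN i h]
    · rw [sign_pos h, abs_of_nonneg]
      · simp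
      · by_cases h' : q ⬝ᵥ Z.col i < 0
        · have := key (mul_neg_of_pos_of_neg h h')
          rw [le_div_iff_of_neg h'] at this
          linarith
        · nlinarith
  refine ⟨p + s • q, ?_, Submodule.finrank_lt_finrank_of_lt (lt_of_le_of_ne ?_ ?_)⟩
  · have h1 : supportValue Z (p + s • q) = (p + s • q) ⬝ᵥ faceCenter Z p := by
      rw [supportValue, faceCenter, dotProduct_mulVec_eq_sum]
      exact Finset.sum_congr rfl fun i _ => habs i
    have h2 : (p + s • q) ⬝ᵥ g = p ⬝ᵥ g := by
      rw [add_dotProduct, smul_dotProduct, hqg, smul_zero, add_zero]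
    rw [hg, dotProduct_sub, dotProduct_sub, dotProduct_faceCenter, ← h1] at h2
    linarith
  · refine Submodule.span_mono (Set.image_mono fun i hi => ?_)
    have hi' : p ⬝ᵥ Z.col i = 0 := hi
    change (p + s • q) ⬝ᵥ Z.col i = 0
    rw [hval, hi', hqN i hi']
    simp
  · intro h
    have hmem : Z.col m ∈ orthogonalSpan Z (p + s • q) := by
      refine Submodule.subset_span ⟨m, ?_, rfl⟩
      change (p + s • q) ⬝ᵥ Z.col m = 0
      rw [hval, hs]
      field_simp
      ring
    rw [← h] at hmem
    exact hpm (dotProduct_eq_zero_of_mem_orthogonalSpan hmem)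

/-- Induction on a bound `k` for the codimension of the orthogonal columns, turning the functional
until the codimension is one. Codimension zero would mean `p = 0`, which separates nothing. -/
theorem exists_facetVector_of_separating {n r : ℕ} {Z : Matrix (Fin n) (Fin r) ℝ}
    (hZ : Submodule.span ℝ (Set.range Z.col) = ⊤) (x : Fin n → ℝ) (k : ℕ) :
    ∀ p : Fin n → ℝ, n ≤ Module.finrank ℝ (orthogonalSpan Z p) + k →
      supportValue Z p < p ⬝ᵥ x →
      ∃ p' : Fin n → ℝ, IsFacetVector (zonotope Z) p' ∧ supportValue Z p' < p' ⬝ᵥ x := by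
  induction k with
  | zero =>
    intro p hk hx
    exfalso
    have htop : orthogonalSpan Z p = ⊤ :=
      Submodule.eq_top_of_finrank_eq (le_antisymm (Submodule.finrank_le _) (by simpa using hk))
    have hp : p = 0 := dotProduct_self_eq_zero.1
      (dotProduct_eq_zero_of_mem_orthogonalSpan (htop ▸ Submodule.mem_top))
    simp [hp, supportValue] at hx
  | succ k ih =>
    intro p hk hx
    by_cases hn : Module.finrank ℝ (orthogonalSpan Z p) + 1 < n
    · obtain ⟨p', hx', hlt⟩ := exists_separating_finrank_lt hZ hx hn
      exact ih p' (by omega) hx'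
    · by_cases hn' : n ≤ Module.finrank ℝ (orthogonalSpan Z p) + k
      · exact ih p hn' hx
      · refine ⟨p, (isFacetVector_zonotope_iff Z p).2 ⟨?_, ?_⟩, hx⟩
        · rintro rfl
          simp [supportValue] at hx
        · have hne : orthogonalSpan Z p ≠ ⊤ := by
            intro htop
            have hp : p = 0 := dotProduct_self_eq_zero.1
              (dotProduct_eq_zero_of_mem_orthogonalSpan (htop ▸ Submodule.mem_top))
            simp [hp, supportValue] at hx
          have := Submodule.finrank_lt hne
          rw [Module.finrank_fin_fun] at this
          omega

theorem zonotope_eq_image {n r : ℕ} (Z : Matrix (Fin n) (Fin r) ℝ) :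
    zonotope Z = Z.mulVecLin '' Set.Icc (-1) 1 := by
  ext x
  simp only [zonotope, Set.mem_ofPred_eq, Set.mem_image, Set.mem_Icc, Pi.le_def, Pi.neg_apply,
    Pi.one_apply, Matrix.mulVecLin_apply, ← forall_and, eq_comm]

/-- A full-dimensional zonotope is the intersection of its facet half-spaces. -/
theorem exists_facetVector_of_notMem_zonotope {n r : ℕ} {Z : Matrix (Fin n) (Fin r) ℝ}
    (hZ : Submodule.span ℝ (Set.range Z.col) = ⊤) {x : Fin n → ℝ} (hx : x ∉ zonotope Z) :
    ∃ p : Fin n → ℝ, IsFacetVector (zonotope Z) p ∧ supportValue Z p < p ⬝ᵥ x := by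
  have hconv : Convex ℝ (zonotope Z) := by
    rw [zonotope_eq_image]
    exact (convex_Icc _ _).linear_image _
  have hclosed : IsClosed (zonotope Z) := by
    rw [zonotope_eq_image]
    exact (isCompact_Icc.image (LinearMap.continuous_of_finiteDimensional _)).isClosed
  obtain ⟨f, u, hf, hu⟩ := geometric_hahn_banach_closed_point hconv hclosed hx
  set p := (dotProductEquiv ℝ (Fin n)).symm f.toLinearMap
  have hp : ∀ y, p ⬝ᵥ y = f y := fun y => by
    change dotProductEquiv ℝ (Fin n) ((dotProductEquiv ℝ (Fin n)).symm f.toLinearMap) y = f y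
    rw [LinearEquiv.apply_symm_apply]
    rfl
  refine exists_facetVector_of_separating hZ x n p (by omega) ?_
  rw [← dotProduct_faceCenter, hp, hp]
  exact (hf _ (faceCenter_mem_zonotope Z p)).trans hu

/-! ### Unimodularity and regular scalings. -/

/-- The columns orthogonal to a facet vector, together with any other column, contain a basis
of the space. -/
theorem exists_linearIndependent_col_of_isFacetVector {n r : ℕ} {Z : Matrix (Fin n) (Fin r) ℝ}
    {p : Fin n → ℝ} (hp : IsFacetVector (zonotope Z) p) {j : Fin r} (hj : p ⬝ᵥ Z.col j ≠ 0) :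
    ∃ b : Fin n → Fin r, LinearIndependent ℝ (fun k => Z.col (b k)) ∧
      ∀ k, p ⬝ᵥ Z.col (b k) = 0 ∨ b k = j := by
  obtain ⟨κ, a, hinj, hspan, hli⟩ :=
    exists_linearIndependent' ℝ (fun i : {i // p ⬝ᵥ Z.col i = 0} => Z.col i)
  have hrange : Set.range (fun i : {i // p ⬝ᵥ Z.col i = 0} => Z.col i)
      = Z.col '' {i | p ⬝ᵥ Z.col i = 0} := by
    rw [Set.image_eq_range]
    rfl
  have hspan' : Submodule.span ℝ (Set.range ((fun i : {i // p ⬝ᵥ Z.col i = 0} => Z.col i) ∘ a))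
      = orthogonalSpan Z p := by
    rw [hspan, hrange, orthogonalSpan]
  have : Fintype κ := Fintype.ofInjective a hinj
  have hcard : Fintype.card (Option κ) = Fintype.card (Fin n) := by
    rw [Fintype.card_option, Fintype.card_fin, ← finrank_span_eq_card hli, hspan']
    exact ((isFacetVector_zonotope_iff Z p).1 hp).2
  have hli' := hli.option (x := Z.col j) (by
    rw [hspan']
    exact fun h => hj (dotProduct_eq_zero_of_mem_orthogonalSpan h))
  let e := (Fintype.equivOfCardEq hcard).symm
  let b' : Option κ → Fin r := fun o => o.casesOn' j fun k => (a k : Fin r)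
  refine ⟨b' ∘ e, ?_, fun k => ?_⟩
  · have h : (fun k => Z.col ((b' ∘ e) k)) = (fun o : Option κ => o.casesOn' (Z.col j)
        ((fun i : {i // p ⬝ᵥ Z.col i = 0} => Z.col i) ∘ a)) ∘ e := by
      funext k
      simp only [Function.comp_apply, b']
      cases e k <;> rfl
    rw [h]
    exact hli'.comp _ e.injective
  · simp only [Function.comp_apply, b']
    cases e k with
    | none => exact Or.inr rfl
    | some k => exact Or.inl (a k).2

/-- Expand the scaled column integrally in a basis consisting of columns orthogonal to `p` and
column `j`: only the latter contributes to the value of `p`. -/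
theorem exists_int_mul_of_isUnimodularSystem {n r : ℕ} {Z : Matrix (Fin n) (Fin r) ℝ}
    {β : Fin r → ℝ} (hβ : ∀ i, 0 < β i) (hU : IsUnimodularSystem fun i => β i • Z.col i)
    {p : Fin n → ℝ} (hp : IsFacetVector (zonotope Z) p) {j : Fin r} (hj : p ⬝ᵥ Z.col j ≠ 0)
    (i : Fin r) : ∃ m : ℤ, p ⬝ᵥ (β i • Z.col i) = m * (p ⬝ᵥ (β j • Z.col j)) := by
  obtain ⟨b, hli, hb⟩ := exists_linearIndependent_col_of_isFacetVector hp hj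
  have hmem := hU b (hli.units_smul fun k => Units.mk0 (β (b k)) (hβ _).ne') i
  dsimp only at hmem
  generalize β i • Z.col i = x at hmem ⊢
  induction hmem using Submodule.span_induction with
  | mem x hx =>
    obtain ⟨k, rfl⟩ := hx
    rcases hb k with h | h
    · exact ⟨0, by simp [dotProduct_smul, h]⟩
    · exact ⟨1, by simp [h]⟩
  | zero => exact ⟨0, by simp⟩
  | add x y _ _ hx hy =>
    obtain ⟨m, hm⟩ := hx
    obtain ⟨m', hm'⟩ := hy
    exact ⟨m + m', by rw [dotProduct_add, hm, hm']; push_cast; ring⟩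
  | smul c x _ hx =>
    obtain ⟨m, hm⟩ := hx
    exact ⟨c * m, by rw [dotProduct_smul, hm, zsmul_eq_mul]; push_cast; ring⟩

theorem exists_isRegularScaling {n r : ℕ} {Z : Matrix (Fin n) (Fin r) ℝ}
    (hZ : Submodule.span ℝ (Set.range Z.col) = ⊤)
    {β : Fin r → ℝ} (hβ : ∀ i, 0 < β i) (hU : IsUnimodularSystem fun i => β i • Z.col i)
    {p : Fin n → ℝ} (hp : IsFacetVector (zonotope Z) p) : ∃ γ, IsRegularScaling Z β p γ := by
  obtain ⟨j, hj⟩ := exists_dotProduct_col_ne_zero hZ hp.1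
  have hne : ∀ i, p ⬝ᵥ Z.col i ≠ 0 → p ⬝ᵥ (β i • Z.col i) ≠ 0 := fun i hi => by
    rw [dotProduct_smul, smul_eq_mul]
    exact mul_ne_zero (hβ i).ne' hi
  refine ⟨|p ⬝ᵥ (β j • Z.col j)|⁻¹, inv_pos.2 (abs_pos.2 (hne j hj)), fun i => ?_⟩
  by_cases hi : p ⬝ᵥ Z.col i = 0
  · simp [dotProduct_smul, hi]
  · obtain ⟨m, hm⟩ := exists_int_mul_of_isUnimodularSystem hβ hU hp hj i
    obtain ⟨m', hm'⟩ := exists_int_mul_of_isUnimodularSystem hβ hU hp hi j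
    -- Each nonzero value is an integer multiple of the other, so the factors are units and the
    -- absolute values agree.
    have hmm : m' * m = 1 := by
      have h : ((m' * m : ℤ) : ℝ) * (p ⬝ᵥ (β j • Z.col j)) = 1 * (p ⬝ᵥ (β j • Z.col j)) := by
        push_cast
        rw [mul_assoc, ← hm, ← hm', one_mul]
      exact_mod_cast mul_right_cancel₀ (hne j hj) h
    have habs : |p ⬝ᵥ (β i • Z.col i)| = |p ⬝ᵥ (β j • Z.col j)| := by
      rw [hm, abs_mul]
      rcases Int.isUnit_iff.1 (IsUnit.of_mul_eq_one_right _ hmm) with rfl | rfl <;> simp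
    rw [← habs, inv_mul_eq_div]
    rcases abs_choice (p ⬝ᵥ (β i • Z.col i)) with h | h <;> rw [h]
    · rw [div_self (hne i hi)]
      simp
    · rw [div_neg, div_self (hne i hi)]
      simp

theorem IsRegularScaling.mul_dotProduct_col {n r : ℕ} {Z : Matrix (Fin n) (Fin r) ℝ}
    {β : Fin r → ℝ} (hβ : ∀ i, 0 < β i) {p : Fin n → ℝ} {γ : ℝ} (h : IsRegularScaling Z β p γ)
    (i : Fin r) : γ * β i * (p ⬝ᵥ Z.col i) = signVector Z p i := by
  have hpos : 0 < γ * β i := mul_pos h.1 (hβ i)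
  have hmem := h.2 i
  rw [dotProduct_smul, smul_eq_mul, ← mul_assoc] at hmem
  have hsign : signVector Z p i
      = (SignType.sign (γ * β i * (p ⬝ᵥ Z.col i)) : ℝ) := by
    rw [sign_mul, sign_pos hpos, one_mul, signVector]
  rw [hsign]
  generalize γ * β i * (p ⬝ᵥ Z.col i) = a at hmem ⊢
  rcases hmem with rfl | rfl | rfl <;> simp

/-! ### The quadratic form of the scaled matrix. -/

theorem scaledMatrix_mul_transpose_mulVec {n r : ℕ} (Z : Matrix (Fin n) (Fin r) ℝ)
    {β : Fin r → ℝ} (hβ : ∀ i, 0 < β i) (w : Fin n → ℝ) :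
    (scaledMatrix Z β * (scaledMatrix Z β)ᵀ) *ᵥ w
      = Z *ᵥ fun i => 2 * β i * (w ⬝ᵥ Z.col i) := by
  rw [← Matrix.mulVec_mulVec]
  funext k
  simp only [Matrix.mulVec, dotProduct, scaledMatrix, Matrix.of_apply, Matrix.transpose_apply,
    Matrix.col_apply]
  refine Finset.sum_congr rfl fun i _ => ?_
  have hs : √(2 * β i) * √(2 * β i) = 2 * β i :=
    Real.mul_self_sqrt (by linarith [hβ i])
  rw [Finset.mul_sum, Finset.mul_sum, Finset.mul_sum]
  refine Finset.sum_congr rfl fun l _ => ?_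
  linear_combination Z k i * Z l i * w l * hs

theorem dotProduct_scaledMatrix_mul_transpose_mulVec {n r : ℕ} (Z : Matrix (Fin n) (Fin r) ℝ)
    {β : Fin r → ℝ} (hβ : ∀ i, 0 < β i) (w : Fin n → ℝ) :
    w ⬝ᵥ (scaledMatrix Z β * (scaledMatrix Z β)ᵀ) *ᵥ w
      = ∑ i, 2 * β i * (w ⬝ᵥ Z.col i) ^ 2 := by
  rw [scaledMatrix_mul_transpose_mulVec Z hβ, dotProduct_mulVec_eq_sum]
  exact Finset.sum_congr rfl fun i _ => by ring

theorem posDef_scaledMatrix_mul_transpose {n r : ℕ} {Z : Matrix (Fin n) (Fin r) ℝ}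
    (hZ : Submodule.span ℝ (Set.range Z.col) = ⊤) {β : Fin r → ℝ} (hβ : ∀ i, 0 < β i) :
    (scaledMatrix Z β * (scaledMatrix Z β)ᵀ).PosDef := by
  refine Matrix.PosDef.of_dotProduct_mulVec_pos ?_ fun w hw => ?_
  · rw [Matrix.IsHermitian, Matrix.conjTranspose_eq_transpose_of_trivial, Matrix.transpose_mul,
      Matrix.transpose_transpose]
  · rw [star_trivial, dotProduct_scaledMatrix_mul_transpose_mulVec Z hβ]
    obtain ⟨j, hj⟩ := exists_dotProduct_col_ne_zero hZ hw
    refine Finset.sum_pos' (fun i _ => ?_) ⟨j, Finset.mem_univ _, ?_⟩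
    · have := hβ i
      positivity
    · have := hβ j
      positivity

/-- The map `Z_β Z_βᵀ` takes a regularly scaled facet vector to the translation vector. -/
theorem IsRegularScaling.scaledMatrix_mulVec_smul {n r : ℕ} {Z : Matrix (Fin n) (Fin r) ℝ}
    {β : Fin r → ℝ} (hβ : ∀ i, 0 < β i) {p : Fin n → ℝ} {γ : ℝ} (h : IsRegularScaling Z β p γ) :
    (scaledMatrix Z β * (scaledMatrix Z β)ᵀ) *ᵥ (γ • p) = (2 : ℝ) • faceCenter Z p := by
  rw [scaledMatrix_mul_transpose_mulVec Z hβ, faceCenter, ← Matrix.mulVec_smul]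
  congr 1
  funext i
  rw [Pi.smul_apply, ← h.mul_dotProduct_col hβ, smul_dotProduct]
  simp only [smul_eq_mul]
  ring

open scoped MatrixOrder Matrix.Norms.L2Operator in
theorem Matrix.PosSemidef.exists_transpose_mul_self {n : ℕ} {Q : Matrix (Fin n) (Fin n) ℝ}
    (h : Q.PosSemidef) : ∃ A : Matrix (Fin n) (Fin n) ℝ, Aᵀ * A = Q := by
  obtain ⟨A, hA⟩ := CStarAlgebra.nonneg_iff_eq_star_mul_self.1 h.nonneg
  refine ⟨A, ?_⟩
  rw [hA, Matrix.star_eq_conjTranspose, Matrix.conjTranspose_eq_transpose_of_trivial]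

/-! ### The lattice and its Voronoi polytope. -/

/-- The facet vectors of a full-dimensional zonotope separate points from the origin. -/
theorem eq_zero_of_forall_isFacetVector_dotProduct_eq_zero {n r : ℕ}
    {Z : Matrix (Fin n) (Fin r) ℝ} (hZ : Submodule.span ℝ (Set.range Z.col) = ⊤) {y : Fin n → ℝ}
    (h : ∀ p, IsFacetVector (zonotope Z) p → p ⬝ᵥ y = 0) : y = 0 := by
  have hmem : ∀ s : ℝ, s • y ∈ zonotope Z := by
    intro s
    by_contra hs
    obtain ⟨p, hp, hlt⟩ := exists_facetVector_of_notMem_zonotope hZ hs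
    rw [dotProduct_smul, h p hp, smul_zero] at hlt
    exact hlt.not_ge (Finset.sum_nonneg fun i _ => abs_nonneg _)
  by_contra hy
  have hne : y ⬝ᵥ y ≠ 0 := fun h0 => hy (dotProduct_self_eq_zero.1 h0)
  -- This multiple of `y` overshoots the support value by one.
  have := dotProduct_le_supportValue Z y (hmem ((supportValue Z y + 1) / (y ⬝ᵥ y)))
  rw [dotProduct_smul, smul_eq_mul, div_mul_cancel₀ _ hne] at this
  linarith

/-- On a generator `At` the value is `γβᵢ(p·zᵢ)`, a sign; integrality passes to integer
combinations. -/
theorem exists_int_of_mem_span_translationVectors {n r : ℕ} {Z : Matrix (Fin n) (Fin r) ℝ}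
    (hZ : Submodule.span ℝ (Set.range Z.col) = ⊤)
    {β : Fin r → ℝ} (hβ : ∀ i, 0 < β i) (hU : IsUnimodularSystem fun i => β i • Z.col i)
    {A : Matrix (Fin n) (Fin n) ℝ} (hA : Aᵀ * A * (scaledMatrix Z β * (scaledMatrix Z β)ᵀ) = 1)
    {v : Fin n → ℝ}
    (hv : v ∈ Submodule.span ℤ ((fun x => A *ᵥ x) '' translationVectors (zonotope Z)))
    (i : Fin r) : ∃ m : ℤ, β i * ((Aᵀ *ᵥ v) ⬝ᵥ Z.col i) = m := by
  induction hv using Submodule.span_induction with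
  | mem x hx =>
    obtain ⟨t, ⟨p, ht⟩, rfl⟩ := hx
    obtain ⟨hp, rfl⟩ := (isTranslationVector_zonotope_iff Z p t).1 ht
    obtain ⟨γ, hγ⟩ := exists_isRegularScaling hZ hβ hU hp
    have h : Aᵀ *ᵥ (A *ᵥ ((2 : ℝ) • faceCenter Z p)) = γ • p := by
      rw [← hγ.scaledMatrix_mulVec_smul hβ, Matrix.mulVec_mulVec, Matrix.mulVec_mulVec, hA,
        Matrix.one_mulVec]
    refine ⟨SignType.sign (p ⬝ᵥ Z.col i), ?_⟩
    dsimp only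
    rw [h, smul_dotProduct, smul_eq_mul, ← mul_assoc, mul_comm (β i),
      hγ.mul_dotProduct_col hβ, signVector]
    cases SignType.sign (p ⬝ᵥ Z.col i) <;> simp
  | zero => exact ⟨0, by simp⟩
  | add x y _ _ hx hy =>
    obtain ⟨m, hm⟩ := hx
    obtain ⟨m', hm'⟩ := hy
    exact ⟨m + m', by
      rw [Matrix.mulVec_add, add_dotProduct, mul_add, hm, hm', Int.cast_add]⟩
  | smul c x _ hx =>
    obtain ⟨m, hm⟩ := hx
    refine ⟨c * m, ?_⟩
    rw [Matrix.mulVec_smul, smul_dotProduct, zsmul_eq_mul, mul_left_comm, hm, Int.cast_mul]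

theorem isLatticeIn_span_translationVectors {n r : ℕ} {Z : Matrix (Fin n) (Fin r) ℝ}
    (hZ : Submodule.span ℝ (Set.range Z.col) = ⊤)
    {β : Fin r → ℝ} (hβ : ∀ i, 0 < β i) (hU : IsUnimodularSystem fun i => β i • Z.col i)
    {A : Matrix (Fin n) (Fin n) ℝ} (hA : Aᵀ * A * (scaledMatrix Z β * (scaledMatrix Z β)ᵀ) = 1) :
    IsLatticeIn (Submodule.span ℤ ((fun x => A *ᵥ x) '' translationVectors (zonotope Z))) := by
  set L := Submodule.span ℤ ((fun x => A *ᵥ x) '' translationVectors (zonotope Z))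
  have hright : A * ((scaledMatrix Z β * (scaledMatrix Z β)ᵀ) * Aᵀ) = 1 := by
    rw [← Matrix.mul_assoc, mul_eq_one_comm, ← Matrix.mul_assoc]
    exact hA
  have hdisc : DiscreteTopology L := by
    rw [discreteTopology_iff_isOpen_singleton_zero]
    -- Integers of absolute value below one vanish, and the columns span, so finitely many open
    -- conditions isolate `0`.
    have heq : ({0} : Set L) = ⋂ i, {v : L | |β i * ((Aᵀ *ᵥ (v : Fin n → ℝ)) ⬝ᵥ Z.col i)| < 1} := by
      ext v
      simp only [Set.mem_singleton_iff, Set.mem_iInter, Set.mem_ofPred_eq]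
      constructor
      · rintro rfl i
        simp
      · intro h
        have hw : Aᵀ *ᵥ (v : Fin n → ℝ) = 0 := by
          by_contra hne
          obtain ⟨i, hi⟩ := exists_dotProduct_col_ne_zero hZ hne
          obtain ⟨m, hm⟩ := exists_int_of_mem_span_translationVectors hZ hβ hU hA v.2 i
          have hi' := h i
          rw [hm] at hi'
          have hm0 : m = 0 := Int.abs_lt_one_iff.1 (by exact_mod_cast hi')
          rw [hm0, Int.cast_zero] at hm
          exact mul_ne_zero (hβ i).ne' hi hm
        have : (v : Fin n → ℝ) = 0 := by
          rw [← Matrix.one_mulVec (v : Fin n → ℝ), ← hright, ← Matrix.mul_assoc,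
            ← Matrix.mulVec_mulVec, hw, Matrix.mulVec_zero]
        exact Subtype.ext this
    rw [heq]
    refine isOpen_iInter_of_finite fun i => isOpen_lt ?_ continuous_const
    exact (continuous_const.mul ((Continuous.matrix_mulVec continuous_const
      continuous_subtype_val).dotProduct continuous_const)).abs
  refine ⟨hdisc, ⟨?_⟩⟩
  by_contra hne
  obtain ⟨y, hy, hyL⟩ := exists_dotProduct_eq_zero_of_ne_top hne
  -- If `y` is orthogonal to every `At`, then `S Aᵀ y` is orthogonal to every facet vector, since
  -- `At = A S (γp)`.
  have hz : ((scaledMatrix Z β * (scaledMatrix Z β)ᵀ) * Aᵀ) *ᵥ y = 0 := by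
    refine eq_zero_of_forall_isFacetVector_dotProduct_eq_zero hZ fun p hp => ?_
    obtain ⟨γ, hγ⟩ := exists_isRegularScaling hZ hβ hU hp
    have h0 := hyL _ (Submodule.subset_span (Submodule.subset_span
      ⟨_, ⟨p, (isTranslationVector_zonotope_iff Z p _).2 ⟨hp, rfl⟩⟩, rfl⟩))
    rw [← hγ.scaledMatrix_mulVec_smul hβ] at h0
    have hp' : (γ • p) = Aᵀ *ᵥ (A *ᵥ ((scaledMatrix Z β * (scaledMatrix Z β)ᵀ) *ᵥ (γ • p))) := by
      rw [Matrix.mulVec_mulVec, Matrix.mulVec_mulVec, hA, Matrix.one_mulVec]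
    have h1 : (γ • p) ⬝ᵥ ((scaledMatrix Z β * (scaledMatrix Z β)ᵀ) * Aᵀ) *ᵥ y = 0 := by
      rw [hp', dotProduct_comm, Matrix.dotProduct_transpose_mulVec, Matrix.mulVec_mulVec y A,
        hright, Matrix.one_mulVec, dotProduct_comm]
      exact h0
    rw [smul_dotProduct, smul_eq_mul] at h1
    exact (mul_eq_zero.1 h1).resolve_left hγ.1.ne'
  apply hy
  rw [← Matrix.one_mulVec y, ← hright, ← Matrix.mulVec_mulVec, hz, Matrix.mulVec_zero]

theorem dotProduct_self_le_sub_iff {n : ℕ} (x v : Fin n → ℝ) :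
    x ⬝ᵥ x ≤ (x - v) ⬝ᵥ (x - v) ↔ 2 * (x ⬝ᵥ v) ≤ v ⬝ᵥ v := by
  rw [sub_dotProduct, dotProduct_sub, dotProduct_sub, dotProduct_comm v x]
  constructor <;> intro h <;> linarith

theorem image_zonotope_eq_voronoiPolytope {n r : ℕ} {Z : Matrix (Fin n) (Fin r) ℝ}
    (hZ : Submodule.span ℝ (Set.range Z.col) = ⊤)
    {β : Fin r → ℝ} (hβ : ∀ i, 0 < β i) (hU : IsUnimodularSystem fun i => β i • Z.col i)
    {A : Matrix (Fin n) (Fin n) ℝ} (hA : Aᵀ * A * (scaledMatrix Z β * (scaledMatrix Z β)ᵀ) = 1) :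
    (fun x => A *ᵥ x) '' zonotope Z = voronoiPolytope
      (Submodule.span ℤ ((fun x => A *ᵥ x) '' translationVectors (zonotope Z))) := by
  have hright : A * ((scaledMatrix Z β * (scaledMatrix Z β)ᵀ) * Aᵀ) = 1 := by
    rw [← Matrix.mul_assoc, mul_eq_one_comm, ← Matrix.mul_assoc]
    exact hA
  have hnorm : ∀ v, v ⬝ᵥ v = ∑ i, 2 * β i * ((Aᵀ *ᵥ v) ⬝ᵥ Z.col i) ^ 2 := by
    intro v
    rw [← dotProduct_scaledMatrix_mul_transpose_mulVec Z hβ, dotProduct_comm (Aᵀ *ᵥ v),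
      Matrix.dotProduct_transpose_mulVec, Matrix.mulVec_mulVec, Matrix.mulVec_mulVec,
      Matrix.mul_assoc A, hright, Matrix.one_mulVec]
  apply Set.Subset.antisymm
  · rintro _ ⟨_, ⟨y, hy, rfl⟩, rfl⟩ v hv
    rw [dotProduct_self_le_sub_iff, hnorm v, dotProduct_comm,
      ← Matrix.dotProduct_transpose_mulVec, dotProduct_comm, dotProduct_mulVec_eq_sum,
      Finset.mul_sum]
    refine Finset.sum_le_sum fun i _ => ?_
    obtain ⟨m, hm⟩ := exists_int_of_mem_span_translationVectors hZ hβ hU hA hv i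
    set a := (Aᵀ *ᵥ v) ⬝ᵥ Z.col i
    have h1 : y i * a ≤ |a| := mul_le_abs_of_mem_Icc (hy i)
    have h2 : |a| ≤ β i * a ^ 2 := by
      have hint : |(m : ℝ)| ≤ (m : ℝ) ^ 2 := by
        exact_mod_cast (Int.natCast_natAbs m) ▸ Int.natAbs_le_self_sq m
      rw [← hm, abs_mul, abs_of_pos (hβ i)] at hint
      refine le_of_mul_le_mul_left (hint.trans_eq ?_) (hβ i)
      ring
    linarith
  · intro x hx
    set x₀ := ((scaledMatrix Z β * (scaledMatrix Z β)ᵀ) * Aᵀ) *ᵥ x with hx₀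
    have hxA : A *ᵥ x₀ = x := by
      rw [hx₀, Matrix.mulVec_mulVec, hright, Matrix.one_mulVec]
    refine ⟨x₀, ?_, hxA⟩
    by_contra hmem
    obtain ⟨p, hp, hlt⟩ := exists_facetVector_of_notMem_zonotope hZ hmem
    obtain ⟨γ, hγ⟩ := exists_isRegularScaling hZ hβ hU hp
    -- For `v = At` one has `x·v = γ(p·x₀)` and `v·v = 2γ` times the support value, so the Voronoi
    -- inequality contradicts the violated facet inequality.
    have h := hx (A *ᵥ ((2 : ℝ) • faceCenter Z p)) (Submodule.subset_span
      ⟨_, ⟨p, (isTranslationVector_zonotope_iff Z p _).2 ⟨hp, rfl⟩⟩, rfl⟩)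
    have ht : Aᵀ *ᵥ (A *ᵥ ((2 : ℝ) • faceCenter Z p)) = γ • p := by
      rw [← hγ.scaledMatrix_mulVec_smul hβ, Matrix.mulVec_mulVec, Matrix.mulVec_mulVec, hA,
        Matrix.one_mulVec]
    have hdot : ∀ u, (A *ᵥ u) ⬝ᵥ (A *ᵥ ((2 : ℝ) • faceCenter Z p)) = γ * (p ⬝ᵥ u) := fun u => by
      rw [dotProduct_comm, ← Matrix.dotProduct_transpose_mulVec, ht, dotProduct_comm,
        smul_dotProduct, smul_eq_mul]
    rw [dotProduct_self_le_sub_iff, hdot, ← hxA, hdot, dotProduct_smul, dotProduct_faceCenter,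
      smul_eq_mul] at h
    nlinarith [mul_lt_mul_of_pos_left hlt hγ.1]

theorem theorem2 {n r : ℕ} (Z : Matrix (Fin n) (Fin r) ℝ) (β : Fin r → ℝ)
    (hP : IsParallelotope (zonotope Z))
    (hβ : ∀ i, 0 < β i)
    (hZ : IsUnimodularSystem fun i => β i • Z.col i)
    (Q : Matrix (Fin n) (Fin n) ℝ)
    (hQ : Q = (scaledMatrix Z β * (scaledMatrix Z β)ᵀ)⁻¹) :
    (scaledMatrix Z β * (scaledMatrix Z β)ᵀ).PosDef ∧
    (∀ p : Fin n → ℝ, IsFacetVector (zonotope Z) p →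
      (∃ γ : ℝ, IsRegularScaling Z β p γ) ∧
      (∃ t : Fin n → ℝ, IsTranslationVector (zonotope Z) p t) ∧
      ∀ (γ : ℝ) (t : Fin n → ℝ), IsRegularScaling Z β p γ →
        IsTranslationVector (zonotope Z) p t → γ • p = Q *ᵥ t) ∧
    (∃ A : Matrix (Fin n) (Fin n) ℝ, Aᵀ * A = Q) ∧
    ∀ A : Matrix (Fin n) (Fin n) ℝ, Aᵀ * A = Q →
      IsLatticeIn (Submodule.span ℤ ((fun x => A *ᵥ x) '' translationVectors (zonotope Z))) ∧
      (fun x => A *ᵥ x) '' zonotope Z =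
        voronoiPolytope
          (Submodule.span ℤ ((fun x => A *ᵥ x) '' translationVectors (zonotope Z))) := by
  have hspan := span_col_eq_top_of_interior_nonempty hP.2.1
  have hpos := posDef_scaledMatrix_mul_transpose hspan hβ
  have hQS : Q * (scaledMatrix Z β * (scaledMatrix Z β)ᵀ) = 1 := by
    rw [hQ]
    exact Matrix.nonsing_inv_mul _ ((Matrix.isUnit_iff_isUnit_det _).1 hpos.isUnit)
  refine ⟨hpos, fun p hp => ⟨exists_isRegularScaling hspan hβ hZ hp,
    ⟨_, (isTranslationVector_zonotope_iff Z p _).2 ⟨hp, rfl⟩⟩, fun γ t hγ ht => ?_⟩,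
    ?_, fun A hA => ?_⟩
  · rw [((isTranslationVector_zonotope_iff Z p t).1 ht).2, ← hγ.scaledMatrix_mulVec_smul hβ,
      Matrix.mulVec_mulVec, hQS, Matrix.one_mulVec]
  · exact (hQ ▸ hpos.inv).posSemidef.exists_transpose_mul_self
  · rw [← hA] at hQS
    exact ⟨isLatticeIn_span_translationVectors hspan hβ hZ hQS,
      image_zonotope_eq_voronoiPolytope hspan hβ hZ hQS⟩
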